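/- **Theorem (First Epsilon Theorem for $\mathrm{EC}_\varepsilon^=$).** Fix function symbols (constants being the $0$-ary ones) and predicate symbols of arbitrary finite arities. The quantifier-free language with identity $L_\varepsilon^=$ has as terms the variables, $f(t_1,\dots,t_n)$, and the $\varepsilon$-terms $\varepsilon_x A(x)$, where $A(x)$ is a formula in which $x$ occurs free; its formulas are built from $\bot$, $\top$, $P(t_1,\dots,t_n)$ and $t=u$ by $\lnot,\land,\lor,\to,\leftrightarrow$. Expressions are identified up to renaming of bound variables, and substitution is capture-avoiding. The language $L_{\mathrm{EC}}^=$ consists of those terms and formulas in which $\varepsilon$ does not occur. The elementary calculus with identity $\mathrm{EC}^=$ has as axioms all formulas of $L_{\mathrm{EC}}^=$ of the forms - $A$, for $A$ a propositional tautology; - $t=t$; - $t=u\to(A(t)\leftrightarrow A(u))$; and modus ponens as its only rule. The (intensional) $\varepsilon$-calculus with identity $\mathrm{EC}_\varepsilon^=$ has as axioms all formulas of $L_\varepsilon^=$ of these three forms together with all critical formulas $A(t)\to A(\varepsilon_x A(x))$ of $L_\varepsilon^=$, and modus ponens as its only rule. A formula is provable in a calculus if it is the last member of a finite sequence of formulas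 each of which is an axiom or follows from two earlier members by modus ponens. If $E$ is a formula that contains no $\varepsilon$-terms and $E$ is provable in $\mathrm{EC}_\varepsilon^=$, then $E$ is provable in $\mathrm{EC}^=$. -/

import Mathlib

universe u v

namespace EpsilonCalculus

/-! ### Syntax

Expressions are considered up to renaming of bound variables and are represented by de Bruijn
indices: in the scope of `m` nested `ε`, the term `Tm.var n` with `n < m` refers to the variable
bound by the `n`-th enclosing `ε` (counted from `0`, from the inside), and `Tm.var (m + n)` is the
free variable number `n`. In `Tm.eps A`, index `0` of `A` is the variable bound
by `ε`. So "a formula `A(x)` with a distinguished variable `x`" is a formula whose index `0` plays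
the role of `x`, and whose index `n + 1` is the variable `n` of the surroundings. -/

mutual

/-- Raw terms over the function and predicate symbols of `L` (constants are `0`-ary function
symbols). -/
inductive Tm (L : FirstOrder.Language.{u, v}) : Type (max u v)
  | var : ℕ → Tm L
  | func : {n : ℕ} → L.Functions n → (Fin n → Tm L) → Tm L
  | eps : Fm L → Tm L

/-- Raw quantifier-free formulas, with identity. -/
inductive Fm (L : FirstOrder.Language.{u, v}) : Type (max u v)
  | bot : Fm L
  | top : Fm L
  | rel : {n : ℕ} → L.Relations n → (Fin n → Tm L) → Fm L
  | eq : Tm L → Tm L → Fm L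
  | neg : Fm L → Fm L
  | and : Fm L → Fm L → Fm L
  | or : Fm L → Fm L → Fm L
  | imp : Fm L → Fm L → Fm L
  | iff : Fm L → Fm L → Fm L

end

variable {L : FirstOrder.Language.{u, v}}

mutual

/-- The variable with index `k` has a free occurrence in the term. -/
def Tm.HasFree : Tm L → ℕ → Prop
  | .var n, k => n = k
  | .func _ ts, k => ∃ i, (ts i).HasFree k
  | .eps A, k => A.HasFree (k + 1)

/-- The variable with index `k` has a free occurrence in the formula. -/
def Fm.HasFree : Fm L → ℕ → Prop
  | .bot, _ => False
  | .top, _ => False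
  | .rel _ ts, k => ∃ i, (ts i).HasFree k
  | .eq t s, k => t.HasFree k ∨ s.HasFree k
  | .neg A, k => A.HasFree k
  | .and A B, k => A.HasFree k ∨ B.HasFree k
  | .or A B, k => A.HasFree k ∨ B.HasFree k
  | .imp A B, k => A.HasFree k ∨ B.HasFree k
  | .iff A B, k => A.HasFree k ∨ B.HasFree k

end

mutual

/-- The raw term is a term of the language with `ε`: every `ε x A` that occurs in it is formed from
a formula `A` in which `x` has a free occurrence. -/
def Tm.WellFormed : Tm L → Prop
  | .var _ => True
  | .func _ ts => ∀ i, (ts i).WellFormed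
  | .eps A => A.WellFormed ∧ A.HasFree 0

/-- The raw formula is a formula of the language with `ε`. -/
def Fm.WellFormed : Fm L → Prop
  | .bot => True
  | .top => True
  | .rel _ ts => ∀ i, (ts i).WellFormed
  | .eq t s => t.WellFormed ∧ s.WellFormed
  | .neg A => A.WellFormed
  | .and A B => A.WellFormed ∧ B.WellFormed
  | .or A B => A.WellFormed ∧ B.WellFormed
  | .imp A B => A.WellFormed ∧ B.WellFormed
  | .iff A B => A.WellFormed ∧ B.WellFormed

end

mutual

/-- The term contains no `ε`. -/
def Tm.EpsFree : Tm L → Prop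
  | .var _ => True
  | .func _ ts => ∀ i, (ts i).EpsFree
  | .eps _ => False

/-- The formula contains no `ε`-terms. -/
def Fm.EpsFree : Fm L → Prop
  | .bot => True
  | .top => True
  | .rel _ ts => ∀ i, (ts i).EpsFree
  | .eq t s => t.EpsFree ∧ s.EpsFree
  | .neg A => A.EpsFree
  | .and A B => A.EpsFree ∧ B.EpsFree
  | .or A B => A.EpsFree ∧ B.EpsFree
  | .imp A B => A.EpsFree ∧ B.EpsFree
  | .iff A B => A.EpsFree ∧ B.EpsFree

end

variable (L) in
/-- Terms of the language with identity and `ε`. -/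
def TrmEps : Set (Tm L) := {t | t.WellFormed}

variable (L) in
/-- Formulas of the language with identity and `ε`. -/
def FrmEps : Set (Fm L) := {A | A.WellFormed}

variable (L) in
/-- Terms of the language of the elementary calculus with identity. -/
def Trm : Set (Tm L) := {t | t.EpsFree}

variable (L) in
/-- Formulas of the language of the elementary calculus with identity. -/
def Frm : Set (Fm L) := {A | A.EpsFree}

/-! ### Substitution -/

/-- The renaming `ρ` in the scope of one more `ε`. -/
def liftRen (ρ : ℕ → ℕ) : ℕ → ℕ
  | 0 => 0
  | n + 1 => ρ n + 1

mutual

/-- Renaming of free variables. -/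
def Tm.rename : Tm L → (ℕ → ℕ) → Tm L
  | .var n, ρ => .var (ρ n)
  | .func f ts, ρ => .func f (fun i => (ts i).rename ρ)
  | .eps A, ρ => .eps (A.rename (liftRen ρ))

/-- Renaming of free variables. -/
def Fm.rename : Fm L → (ℕ → ℕ) → Fm L
  | .bot, _ => .bot
  | .top, _ => .top
  | .rel R ts, ρ => .rel R (fun i => (ts i).rename ρ)
  | .eq t s, ρ => .eq (t.rename ρ) (s.rename ρ)
  | .neg A, ρ => .neg (A.rename ρ)
  | .and A B, ρ => .and (A.rename ρ) (B.rename ρ)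
  | .or A B, ρ => .or (A.rename ρ) (B.rename ρ)
  | .imp A B, ρ => .imp (A.rename ρ) (B.rename ρ)
  | .iff A B, ρ => .iff (A.rename ρ) (B.rename ρ)

end

/-- The substitution `σ` in the scope of one more `ε`: the new bound variable is left alone, and
the free variables of the substituted terms are shifted, so that they are not captured. -/
def liftSubst (σ : ℕ → Tm L) : ℕ → Tm L
  | 0 => .var 0
  | n + 1 => (σ n).rename Nat.succ

mutual

/-- Simultaneous capture-avoiding substitution of terms for the free variables. -/
def Tm.subst : Tm L → (ℕ → Tm L) → Tm L
  | .var n, σ => σ n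
  | .func f ts, σ => .func f (fun i => (ts i).subst σ)
  | .eps A, σ => .eps (A.subst (liftSubst σ))

/-- Simultaneous capture-avoiding substitution of terms for the free variables. -/
def Fm.subst : Fm L → (ℕ → Tm L) → Fm L
  | .bot, _ => .bot
  | .top, _ => .top
  | .rel R ts, σ => .rel R (fun i => (ts i).subst σ)
  | .eq t s, σ => .eq (t.subst σ) (s.subst σ)
  | .neg A, σ => .neg (A.subst σ)
  | .and A B, σ => .and (A.subst σ) (B.subst σ)
  | .or A B, σ => .or (A.subst σ) (B.subst σ)
  | .imp A B, σ => .imp (A.subst σ) (B.subst σ)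
  | .iff A B, σ => .iff (A.subst σ) (B.subst σ)

end

/-- The substitution of `t` for the distinguished variable, all other variables being kept. -/
def instSubst (t : Tm L) : ℕ → Tm L
  | 0 => t
  | n + 1 => .var n

/-- `A(t)`, the result of substituting `t` for the distinguished variable of `A(x)`. -/
def Fm.inst (A : Fm L) (t : Tm L) : Fm L := A.subst (instSubst t)

/-! ### Axioms and proofs -/

/-- The truth value of a formula when each of its atomic formulas `P(t₁, …, tₙ)` and `t = s` gets
the truth value that `w` assigns to it. -/
def Fm.eval (w : Fm L → Prop) : Fm L → Prop
  | .bot => False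
  | .top => True
  | .rel R ts => w (.rel R ts)
  | .eq t s => w (.eq t s)
  | .neg A => ¬ A.eval w
  | .and A B => A.eval w ∧ B.eval w
  | .or A B => A.eval w ∨ B.eval w
  | .imp A B => A.eval w → B.eval w
  | .iff A B => (A.eval w ↔ B.eval w)

/-- The formula is a (propositional) tautology. -/
def Fm.Tautology (A : Fm L) : Prop := ∀ w : Fm L → Prop, A.eval w

/-- The axioms of the elementary calculus with identity, for a language with set of terms `T` and
set of formulas `F`. -/
inductive IdentityAxiom (T : Set (Tm L)) (F : Set (Fm L)) : Fm L → Prop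
  | taut (A : Fm L) (hA : A ∈ F) (h : A.Tautology) : IdentityAxiom T F A
  | eq₁ (t : Tm L) (ht : t ∈ T) : IdentityAxiom T F (.eq t t)
  | eq₂ (t s : Tm L) (A : Fm L) (ht : t ∈ T) (hs : s ∈ T) (hA : A ∈ F) :
      IdentityAxiom T F (.imp (.eq t s) (.iff (A.inst t) (A.inst s)))

/-- The critical formulas `A(t) → A(ε x A(x))`. -/
inductive CriticalFormula : Fm L → Prop
  | crit (A : Fm L) (t : Tm L) (hA : A ∈ FrmEps L) (hx : A.HasFree 0) (ht : t ∈ TrmEps L) :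
      CriticalFormula (.imp (A.inst t) (A.inst (.eps A)))

/-- The axioms of the elementary calculus with identity. -/
def ECEqAxiom (A : Fm L) : Prop := IdentityAxiom (Trm L) (Frm L) A

/-- The axioms of the (intensional) `ε`-calculus with identity. -/
def ECEpsEqAxiom (A : Fm L) : Prop :=
  IdentityAxiom (TrmEps L) (FrmEps L) A ∨ CriticalFormula A

/-- `π` is a proof from the axioms `Ax`: each member of the sequence is an axiom or follows from two
earlier members by modus ponens. -/
def IsProof (Ax : Fm L → Prop) {n : ℕ} (π : Fin n → Fm L) : Prop :=
  ∀ i, Ax (π i) ∨ ∃ j k, j < i ∧ k < i ∧ π k = .imp (π j) (π i)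

/-- `A` is the last formula of a proof from the axioms `Ax`. -/
def Provable (Ax : Fm L → Prop) (A : Fm L) : Prop :=
  ∃ (n : ℕ) (π : Fin (n + 1) → Fm L), IsProof Ax π ∧ π (Fin.last n) = A

/-- Provability in the elementary calculus with identity. -/
def ProvableECEq (A : Fm L) : Prop := Provable ECEqAxiom A

/-- Provability in the `ε`-calculus with identity. -/
def ProvableECEpsEq (A : Fm L) : Prop := Provable ECEpsEqAxiom A

end EpsilonCalculus

/-!
The proof is semantic. In a nonempty structure, interpret `ε x A(x)` as a value that satisfies `A`,
chosen by a fixed choice function on predicates (`Classical.epsilon`). The value of an `ε`-term then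
depends only on the predicate that `A` defines, so that equal terms may be substituted for each
other also inside `ε`-terms, and the critical formulas hold because the chosen value satisfies `A`
as soon as anything does. Hence whatever the `ε`-calculus proves is true in every nonempty structure
(`ProvableECEpsEq.holds`).

It remains to see that an `ε`-free formula `E` without a proof in the elementary calculus fails in
some structure. As `E` does not follow propositionally from any finite set of axioms, compactness,
in the form of an ultraproduct of truth assignments, gives a truth assignment to the atomic formulas
that satisfies all identity axioms and falsifies `E` (`exists_valuation_of_not_provableECEq`). The
identity axioms say that under it `t = s` is a congruence on the `ε`-free terms, and `E` is false in
the quotient of the term algebra by this congruence (`SatisfiesECEq.holds_iff_eval`).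
-/

namespace EpsilonCalculus

open Filter

variable {L : FirstOrder.Language.{u, v}}

/-! ### Semantics of the `ε`-calculus -/

section Semantics

variable {M : Type*}

/-- The assignment `v` in the scope of one more `ε`, whose variable is given the value `a`. -/
def consAssign (a : M) (v : ℕ → M) : ℕ → M
  | 0 => a
  | n + 1 => v n

theorem consAssign_liftRen (a : M) (v : ℕ → M) (ρ : ℕ → ℕ) :
    (fun n => consAssign a v (liftRen ρ n)) = consAssign a (fun n => v (ρ n)) := by
  funext n
  cases n <;> rfl

variable [L.Structure M] [Nonempty M]

variable (M) in
/-- The semantic value of a term: an element depending on the assignment. The value of a formula is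
the set of assignments that make it true, so that both kinds of values form types in the same
universe, as the simultaneous recursion below requires. -/
abbrev TermValue : Type _ := (ℕ → M) → M

mutual

/-- The value of a term under an assignment to its free variables. The value of `ε x A` is chosen
among the elements satisfying `A` if there are any, and is arbitrary otherwise; it depends on `A`
only through the predicate that `A` defines. -/
noncomputable def Tm.val : Tm L → TermValue M
  | .var n => fun v => v n
  | .func f ts => fun v => FirstOrder.Language.Structure.funMap f (fun i => (ts i).val v)
  | .eps A => fun v => Classical.epsilon (fun a : M => consAssign a v ∈ A.truthSet)

/-- The set of assignments under which a formula is true. -/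
noncomputable def Fm.truthSet : Fm L → Set (ℕ → M)
  | .bot => ∅
  | .top => Set.univ
  | .rel R ts => {v | FirstOrder.Language.Structure.RelMap R (fun i => (ts i).val v)}
  | .eq t s => {v | t.val v = s.val v}
  | .neg A => {v | v ∉ A.truthSet}
  | .and A B => {v | v ∈ A.truthSet ∧ v ∈ B.truthSet}
  | .or A B => {v | v ∈ A.truthSet ∨ v ∈ B.truthSet}
  | .imp A B => {v | v ∈ A.truthSet → v ∈ B.truthSet}
  | .iff A B => {v | v ∈ A.truthSet ↔ v ∈ B.truthSet}

end

/-- The formula is true under an assignment to its free variables. -/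
def Fm.Holds (A : Fm L) (v : ℕ → M) : Prop := v ∈ A.truthSet

section

variable (v : ℕ → M) (A B : Fm L)

theorem Fm.holds_bot : ¬ (Fm.bot : Fm L).Holds v := id

theorem Fm.holds_top : (Fm.top : Fm L).Holds v := trivial

theorem Fm.holds_rel {n : ℕ} (R : L.Relations n) (ts : Fin n → Tm L) : (Fm.rel R ts).Holds v ↔
    FirstOrder.Language.Structure.RelMap R (fun i => (ts i).val v) := Iff.rfl

theorem Fm.holds_eq (t s : Tm L) : (Fm.eq t s).Holds v ↔ t.val v = s.val v := Iff.rfl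

theorem Fm.holds_neg : A.neg.Holds v ↔ ¬ A.Holds v := Iff.rfl

theorem Fm.holds_and : (A.and B).Holds v ↔ A.Holds v ∧ B.Holds v := Iff.rfl

theorem Fm.holds_or : (A.or B).Holds v ↔ A.Holds v ∨ B.Holds v := Iff.rfl

theorem Fm.holds_imp : (A.imp B).Holds v ↔ (A.Holds v → B.Holds v) := Iff.rfl

theorem Fm.holds_iff : (A.iff B).Holds v ↔ (A.Holds v ↔ B.Holds v) := Iff.rfl

theorem Tm.val_eps :
    (Tm.eps A).val v = Classical.epsilon (fun a : M => A.Holds (consAssign a v)) := rfl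

end

mutual

theorem Tm.val_rename : ∀ (t : Tm L) (ρ : ℕ → ℕ) (v : ℕ → M),
    (t.rename ρ).val v = t.val (fun n => v (ρ n))
  | .var _, _, _ => by simp [Tm.rename, Tm.val]
  | .func _ ts, ρ, v => by
      simp only [Tm.rename, Tm.val, fun i => Tm.val_rename (ts i) ρ v]
  | .eps A, ρ, v => by
      simp only [Tm.rename, Tm.val_eps, fun a => Fm.holds_rename A (liftRen ρ) (consAssign a v),
        consAssign_liftRen]

theorem Fm.holds_rename : ∀ (A : Fm L) (ρ : ℕ → ℕ) (v : ℕ → M),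
    (A.rename ρ).Holds v ↔ A.Holds (fun n => v (ρ n))
  | .bot, _, _ => by simp only [Fm.rename, Fm.holds_bot]
  | .top, _, _ => by simp only [Fm.rename, Fm.holds_top]
  | .rel _ ts, ρ, v => by
      simp only [Fm.rename, Fm.holds_rel, fun i => Tm.val_rename (ts i) ρ v]
  | .eq t s, ρ, v => by
      simp only [Fm.rename, Fm.holds_eq, Tm.val_rename t ρ v, Tm.val_rename s ρ v]
  | .neg A, ρ, v => by simp only [Fm.rename, Fm.holds_neg, Fm.holds_rename A ρ v]
  | .and A B, ρ, v => by
      simp only [Fm.rename, Fm.holds_and, Fm.holds_rename A ρ v, Fm.holds_rename B ρ v]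
  | .or A B, ρ, v => by
      simp only [Fm.rename, Fm.holds_or, Fm.holds_rename A ρ v, Fm.holds_rename B ρ v]
  | .imp A B, ρ, v => by
      simp only [Fm.rename, Fm.holds_imp, Fm.holds_rename A ρ v, Fm.holds_rename B ρ v]
  | .iff A B, ρ, v => by
      simp only [Fm.rename, Fm.holds_iff, Fm.holds_rename A ρ v, Fm.holds_rename B ρ v]

end

theorem val_liftSubst (a : M) (v : ℕ → M) (σ : ℕ → Tm L) :
    (fun n => (liftSubst σ n).val (consAssign a v)) = consAssign a (fun n => (σ n).val v) := by
  funext n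
  cases n with
  | zero => simp [liftSubst, Tm.val, consAssign]
  | succ n => simp [liftSubst, Tm.val_rename, consAssign]

mutual

theorem Tm.val_subst : ∀ (t : Tm L) (σ : ℕ → Tm L) (v : ℕ → M),
    (t.subst σ).val v = t.val (fun n => (σ n).val v)
  | .var _, _, _ => by simp [Tm.subst, Tm.val]
  | .func _ ts, σ, v => by
      simp only [Tm.subst, Tm.val, fun i => Tm.val_subst (ts i) σ v]
  | .eps A, σ, v => by
      simp only [Tm.subst, Tm.val_eps, fun a => Fm.holds_subst A (liftSubst σ) (consAssign a v),
        val_liftSubst]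

theorem Fm.holds_subst : ∀ (A : Fm L) (σ : ℕ → Tm L) (v : ℕ → M),
    (A.subst σ).Holds v ↔ A.Holds (fun n => (σ n).val v)
  | .bot, _, _ => by simp only [Fm.subst, Fm.holds_bot]
  | .top, _, _ => by simp only [Fm.subst, Fm.holds_top]
  | .rel _ ts, σ, v => by
      simp only [Fm.subst, Fm.holds_rel, fun i => Tm.val_subst (ts i) σ v]
  | .eq t s, σ, v => by
      simp only [Fm.subst, Fm.holds_eq, Tm.val_subst t σ v, Tm.val_subst s σ v]
  | .neg A, σ, v => by simp only [Fm.subst, Fm.holds_neg, Fm.holds_subst A σ v]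
  | .and A B, σ, v => by
      simp only [Fm.subst, Fm.holds_and, Fm.holds_subst A σ v, Fm.holds_subst B σ v]
  | .or A B, σ, v => by
      simp only [Fm.subst, Fm.holds_or, Fm.holds_subst A σ v, Fm.holds_subst B σ v]
  | .imp A B, σ, v => by
      simp only [Fm.subst, Fm.holds_imp, Fm.holds_subst A σ v, Fm.holds_subst B σ v]
  | .iff A B, σ, v => by
      simp only [Fm.subst, Fm.holds_iff, Fm.holds_subst A σ v, Fm.holds_subst B σ v]

end

theorem Fm.holds_inst (A : Fm L) (t : Tm L) (v : ℕ → M) :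
    (A.inst t).Holds v ↔ A.Holds (consAssign (t.val v) v) := by
  have h : (fun n => (instSubst t n).val v) = consAssign (t.val v) v := by
    funext n
    cases n <;> simp [instSubst, consAssign, Tm.val]
  rw [Fm.inst, Fm.holds_subst, h]

/-- Truth in a structure is the propositional truth value determined by the true atoms. -/
theorem Fm.eval_holds (v : ℕ → M) (A : Fm L) : A.eval (fun B => B.Holds v) ↔ A.Holds v := by
  induction A using Fm.rec (motive_1 := fun _ => True) <;>
    simp_all [Fm.eval, Fm.holds_bot, Fm.holds_top, Fm.holds_neg, Fm.holds_and, Fm.holds_or,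
      Fm.holds_imp, Fm.holds_iff]

theorem IdentityAxiom.holds {T : Set (Tm L)} {F : Set (Fm L)} {A : Fm L}
    (h : IdentityAxiom T F A) (v : ℕ → M) : A.Holds v := by
  cases h with
  | taut A _ h => exact (A.eval_holds v).1 (h _)
  | eq₁ t _ => exact rfl
  | eq₂ t s A _ _ _ =>
    simp only [Fm.holds_imp, Fm.holds_iff, Fm.holds_eq, Fm.holds_inst]
    intro h
    rw [h]

theorem CriticalFormula.holds {A : Fm L} (h : CriticalFormula A) (v : ℕ → M) : A.Holds v := by
  cases h with
  | crit A t _ _ _ =>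
    simp only [Fm.holds_imp, Fm.holds_inst, Tm.val_eps]
    intro h
    exact Classical.epsilon_spec (p := fun a : M => A.Holds (consAssign a v)) ⟨_, h⟩

/-- Soundness of the `ε`-calculus. -/
theorem ProvableECEpsEq.holds {A : Fm L} (h : ProvableECEpsEq A) (v : ℕ → M) : A.Holds v := by
  obtain ⟨n, π, hπ, rfl⟩ := h
  suffices ∀ i, (π i).Holds v from this _
  intro i
  induction i using WellFoundedLT.induction with
  | ind i ih =>
    obtain (h | h) | ⟨j, k, hj, hk, h⟩ := hπ i
    · exact h.holds v
    · exact h.holds v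
    · have hik := ih k hk
      rw [h] at hik
      exact hik (ih j hj)

end Semantics

/-! ### Propositional completeness -/

theorem Provable.of_mem_axioms {Ax : Fm L → Prop} {A : Fm L} (h : Ax A) : Provable Ax A :=
  ⟨0, fun _ => A, fun _ => Or.inl h, rfl⟩

theorem Provable.mp {Ax : Fm L → Prop} {A B : Fm L} (hAB : Provable Ax (.imp A B))
    (hA : Provable Ax A) : Provable Ax B := by
  obtain ⟨n, π, hπ, hn⟩ := hAB
  obtain ⟨m, π', hπ', hm⟩ := hA
  refine ⟨n + 1 + (m + 1), Fin.snoc (α := fun _ => Fm L) (Fin.append π π') B, fun i => ?_,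
    by simp⟩
  induction i using Fin.lastCases with
  | last =>
    -- The new last formula follows from the last formulas of the two proofs.
    refine Or.inr ⟨(Fin.natAdd (n + 1) (Fin.last m)).castSucc,
      (Fin.castAdd (m + 1) (Fin.last n)).castSucc, Fin.castSucc_lt_last _,
      Fin.castSucc_lt_last _, ?_⟩
    rw [Fin.snoc_castSucc, Fin.snoc_castSucc, Fin.snoc_last, Fin.append_left, Fin.append_right,
      hn, hm]
  | cast i =>
    induction i using Fin.addCases with
    | left i =>
      refine (hπ i).imp (fun h => by rwa [Fin.snoc_castSucc, Fin.append_left]) ?_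
      rintro ⟨j, k, hj, hk, h⟩
      refine ⟨(Fin.castAdd (m + 1) j).castSucc, (Fin.castAdd (m + 1) k).castSucc, hj, hk, ?_⟩
      rwa [Fin.snoc_castSucc, Fin.snoc_castSucc, Fin.snoc_castSucc, Fin.append_left,
        Fin.append_left, Fin.append_left]
    | right i =>
      refine (hπ' i).imp (fun h => by rwa [Fin.snoc_castSucc, Fin.append_right]) ?_
      rintro ⟨j, k, hj, hk, h⟩
      refine ⟨(Fin.natAdd (n + 1) j).castSucc, (Fin.natAdd (n + 1) k).castSucc, ?_, ?_, ?_⟩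
      · exact Fin.lt_def.2 (Nat.add_lt_add_left (Fin.lt_def.1 hj) _)
      · exact Fin.lt_def.2 (Nat.add_lt_add_left (Fin.lt_def.1 hk) _)
      · rwa [Fin.snoc_castSucc, Fin.snoc_castSucc, Fin.snoc_castSucc, Fin.append_right,
          Fin.append_right, Fin.append_right]

/-- The elementary calculus proves the propositional consequences of finitely many axioms. -/
theorem ProvableECEq.of_list (Γ : List (Fm L)) (hΓ : ∀ A ∈ Γ, ECEqAxiom A ∧ A.EpsFree)
    {E : Fm L} (hE : E.EpsFree) (h : ∀ w, (∀ A ∈ Γ, A.eval w) → E.eval w) : ProvableECEq E := by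
  induction Γ generalizing E with
  | nil => exact .of_mem_axioms (.taut E hE fun w => h w (by simp))
  | cons A Γ ih =>
    have hA := hΓ A (by simp)
    refine Provable.mp (A := A) (ih (fun B hB => hΓ B (by simp [hB])) ?_ ?_) (.of_mem_axioms hA.1)
    · exact ⟨hA.2, hE⟩
    · intro w hw hAw
      exact h w (by simpa using ⟨hAw, hw⟩)

/-- A propositional form of Łoś's theorem, for the ultraproduct of truth assignments. -/
theorem Fm.eval_ultrafilter {ι : Type*} (U : Ultrafilter ι) (w : ι → Fm L → Prop) (A : Fm L) :
    A.eval (fun B => ∀ᶠ i in U, w i B) ↔ ∀ᶠ i in U, A.eval (w i) := by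
  induction A using Fm.rec (motive_1 := fun _ => True) with
  | bot | top | rel | eq => simp only [Fm.eval, eventually_const]
  | neg A ih => simp only [Fm.eval, ih, Ultrafilter.eventually_not]
  | and A B ihA ihB => simp only [Fm.eval, ihA, ihB, eventually_and]
  | or A B ihA ihB => simp only [Fm.eval, ihA, ihB, Ultrafilter.eventually_or]
  | imp A B ihA ihB => simp only [Fm.eval, ihA, ihB, Ultrafilter.eventually_imp]
  | iff A B ihA ihB =>
    simp only [Fm.eval, ihA, ihB, iff_iff_implies_and_implies, eventually_and,
      Ultrafilter.eventually_imp]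
  | _ => trivial

/-- The truth assignment satisfies the axioms of the elementary calculus. Every axiom is in fact
`ε`-free; asking for it makes that observation unnecessary. -/
def SatisfiesECEq (w : Fm L → Prop) : Prop :=
  ∀ A : Fm L, ECEqAxiom A → A.EpsFree → A.eval w

/-- A truth assignment that satisfies all `ε`-free axioms and falsifies the unprovable formula
exists by compactness. -/
theorem exists_valuation_of_not_provableECEq {E : Fm L} (hE : E.EpsFree)
    (h : ¬ ProvableECEq E) :
    ∃ w : Fm L → Prop, SatisfiesECEq w ∧ ¬ E.eval w := by
  -- Otherwise `E` would follow propositionally from the finitely many axioms in `S`.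
  have key : ∀ S : Finset {A : Fm L // ECEqAxiom A ∧ A.EpsFree},
      ∃ w : Fm L → Prop, (∀ A ∈ S, A.1.eval w) ∧ ¬ E.eval w := by
    intro S
    by_contra! hS
    refine h (.of_list (S.toList.map Subtype.val) ?_ hE fun w hw => hS w fun A hA => ?_)
    · intro A hA
      obtain ⟨B, -, rfl⟩ := List.mem_map.1 hA
      exact B.2
    · exact hw _ (List.mem_map_of_mem (Finset.mem_toList.2 hA))
  choose w hw hwE using key
  -- Each axiom belongs to almost all finite sets of axioms with respect to `U`.
  let U := Ultrafilter.of (atTop : Filter (Finset {A : Fm L // ECEqAxiom A ∧ A.EpsFree}))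
  refine ⟨fun B => ∀ᶠ S in U, w S B, fun A hA hA' => ?_, ?_⟩
  · rw [Fm.eval_ultrafilter]
    have hmem : ∀ᶠ S in (atTop : Filter (Finset {A : Fm L // ECEqAxiom A ∧ A.EpsFree})),
        {⟨A, hA, hA'⟩} ≤ S := eventually_ge_atTop _
    exact mem_of_superset (Ultrafilter.of_le _ hmem) fun S hS =>
      hw S ⟨A, hA, hA'⟩ (by simpa using hS)
  · rw [Fm.eval_ultrafilter, ← Ultrafilter.eventually_not]
    exact Eventually.of_forall hwE

/-! ### Renaming and substitution in `ε`-free terms -/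

theorem Tm.epsFree_var (n : ℕ) : (Tm.var n : Tm L).EpsFree := trivial

theorem Tm.EpsFree.rename {t : Tm L} (ht : t.EpsFree) (ρ : ℕ → ℕ) : (t.rename ρ).EpsFree := by
  induction t using Tm.rec (motive_2 := fun _ => True) <;> simp_all [Tm.EpsFree, Tm.rename]

theorem Tm.EpsFree.subst {t : Tm L} (ht : t.EpsFree) {σ : ℕ → Tm L} (hσ : ∀ n, (σ n).EpsFree) :
    (t.subst σ).EpsFree := by
  induction t using Tm.rec (motive_2 := fun _ => True) <;> simp_all [Tm.EpsFree, Tm.subst]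

theorem Fm.EpsFree.subst {A : Fm L} (hA : A.EpsFree) {σ : ℕ → Tm L} (hσ : ∀ n, (σ n).EpsFree) :
    (A.subst σ).EpsFree := by
  induction A using Fm.rec (motive_1 := fun _ => True) <;>
    simp_all [Fm.EpsFree, Fm.subst, Tm.EpsFree.subst]

theorem Fm.EpsFree.inst {A : Fm L} (hA : A.EpsFree) {t : Tm L} (ht : t.EpsFree) :
    (A.inst t).EpsFree := by
  refine hA.subst fun n => ?_
  cases n with
  | zero => exact ht
  | succ n => simp [instSubst, Tm.EpsFree]

theorem Tm.EpsFree.rename_succ_subst {t : Tm L} (ht : t.EpsFree) (s : Tm L) :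
    (t.rename Nat.succ).subst (instSubst s) = t := by
  induction t using Tm.rec (motive_2 := fun _ => True) <;>
    simp_all [Tm.EpsFree, Tm.rename, Tm.subst, instSubst]

/-- Instantiating the tuple that has the distinguished variable at position `i`, and the given terms
elsewhere, replaces the entry at `i`. -/
theorem update_rename_subst {n : ℕ} {ts : Fin n → Tm L}
    (hts : ∀ j, (ts j).EpsFree) (i : Fin n) (t : Tm L) :
    (fun j => (Function.update (fun j => (ts j).rename Nat.succ) i (.var 0) j).subst
      (instSubst t)) = Function.update ts i t := by
  funext j
  by_cases hj : j = i
  · subst hj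
    simp [Tm.subst, instSubst]
  · simp [hj, (hts j).rename_succ_subst]

theorem epsFree_update_rename {n : ℕ} {ts : Fin n → Tm L}
    (hts : ∀ j, (ts j).EpsFree) (i j : Fin n) :
    (Function.update (fun j => (ts j).rename Nat.succ) i (.var 0) j).EpsFree := by
  by_cases hj : j = i
  · subst hj
    simp [Tm.EpsFree]
  · simpa [hj] using (hts j).rename _

/-! ### The term model of a truth assignment -/

namespace SatisfiesECEq

theorem refl {w : Fm L → Prop} (hw : SatisfiesECEq w) {t : Tm L} (ht : t.EpsFree) :
    w (.eq t t) :=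
  hw _ (.eq₁ t ht) ⟨ht, ht⟩

theorem eval_inst_iff {w : Fm L → Prop} (hw : SatisfiesECEq w) {t s : Tm L} (ht : t.EpsFree)
    (hs : s.EpsFree) (h : w (.eq t s)) {A : Fm L} (hA : A.EpsFree) :
    (A.inst t).eval w ↔ (A.inst s).eval w :=
  hw _ (.eq₂ t s A ht hs hA) ⟨⟨ht, hs⟩, hA.inst ht, hA.inst hs⟩ h

theorem symm {w : Fm L → Prop} (hw : SatisfiesECEq w) {t s : Tm L} (ht : t.EpsFree)
    (hs : s.EpsFree) (h : w (.eq t s)) : w (.eq s t) := by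
  -- `A(x)` is `x = t`, so that `A(t)` is `t = t` and `A(s)` is `s = t`.
  have key := hw.eval_inst_iff ht hs h (A := .eq (.var 0) (t.rename Nat.succ))
    ⟨trivial, ht.rename _⟩
  simp only [Fm.inst, Fm.subst, Tm.subst, ht.rename_succ_subst, instSubst, Fm.eval] at key
  exact key.1 (hw.refl ht)

theorem trans {w : Fm L → Prop} (hw : SatisfiesECEq w) {t s r : Tm L} (ht : t.EpsFree)
    (hs : s.EpsFree) (hr : r.EpsFree) (h : w (.eq t s)) (h' : w (.eq s r)) : w (.eq t r) := by
  have key := hw.eval_inst_iff hs hr h' (A := .eq (t.rename Nat.succ) (.var 0))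
    ⟨ht.rename _, trivial⟩
  simp only [Fm.inst, Fm.subst, Tm.subst, ht.rename_succ_subst, instSubst, Fm.eval] at key
  exact key.1 h

/-- A property of tuples of terms that is invariant under replacing a single entry by an equal term
is invariant under replacing all of them. -/
theorem tuple_congr {w : Fm L → Prop} {n : ℕ} {P : (Fin n → Tm L) → Prop}
    (hP : ∀ (ts : Fin n → Tm L) (i : Fin n) (t s : Tm L), (∀ j, (ts j).EpsFree) → t.EpsFree →
      s.EpsFree → w (.eq t s) → P (Function.update ts i t) → P (Function.update ts i s))
    {ts ss : Fin n → Tm L} (hts : ∀ i, (ts i).EpsFree) (hss : ∀ i, (ss i).EpsFree)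
    (h : ∀ i, w (.eq (ts i) (ss i))) (hPts : P ts) : P ss := by
  -- Replace the entries with index in `S`, for larger and larger `S`.
  suffices ∀ S : Finset (Fin n), P (S.piecewise ss ts) by
    simpa using this Finset.univ
  intro S
  induction S using Finset.induction_on with
  | empty => simpa using hPts
  | insert i S hi ih =>
    rw [Finset.piecewise_insert]
    refine hP _ i (ts i) (ss i) (fun j => ?_) (hts i) (hss i) (h i) ?_
    · by_cases hj : j ∈ S <;> simp [hj, hts, hss]
    · rwa [← Finset.piecewise_eq_of_notMem S ss ts hi, Function.update_eq_self]

theorem rel_congr {w : Fm L → Prop} (hw : SatisfiesECEq w) {n : ℕ} (R : L.Relations n)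
    {ts ss : Fin n → Tm L} (hts : ∀ i, (ts i).EpsFree) (hss : ∀ i, (ss i).EpsFree)
    (h : ∀ i, w (.eq (ts i) (ss i))) (hR : w (.rel R ts)) : w (.rel R ss) := by
  refine tuple_congr (P := fun ts => w (.rel R ts)) ?_ hts hss h hR
  intro ts i t s hts ht hs h
  have key := hw.eval_inst_iff ht hs h
    (A := .rel R (Function.update (fun j => (ts j).rename Nat.succ) i (.var 0)))
    (epsFree_update_rename hts i)
  simp only [Fm.inst, Fm.subst, Fm.eval, update_rename_subst hts] at key
  exact key.1

theorem func_congr {w : Fm L → Prop} (hw : SatisfiesECEq w) {n : ℕ} (f : L.Functions n)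
    {ts ss : Fin n → Tm L} (hts : ∀ i, (ts i).EpsFree) (hss : ∀ i, (ss i).EpsFree)
    (h : ∀ i, w (.eq (ts i) (ss i))) : w (.eq (.func f ts) (.func f ss)) := by
  have hf : (Tm.func f ts).EpsFree := hts
  refine tuple_congr (P := fun rs => w (.eq (.func f ts) (.func f rs))) ?_ hts hss h (hw.refl hf)
  intro rs i t s hrs ht hs h
  have key := hw.eval_inst_iff ht hs h
    (A := .eq ((Tm.func f ts).rename Nat.succ)
      (.func f (Function.update (fun j => (rs j).rename Nat.succ) i (.var 0))))
    ⟨hf.rename _, epsFree_update_rename hrs i⟩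
  simp only [Fm.inst, Fm.subst, hf.rename_succ_subst] at key
  simp only [Tm.subst, Fm.eval, update_rename_subst hrs] at key
  exact key.1

/-- Equality of `ε`-free terms under a truth assignment. -/
def setoid {w : Fm L → Prop} (hw : SatisfiesECEq w) : Setoid {t : Tm L // t.EpsFree} where
  r t s := w (.eq t.1 s.1)
  iseqv := ⟨fun t => hw.refl t.2, fun {t s} => hw.symm t.2 s.2,
    fun {t s r} => hw.trans t.2 s.2 r.2⟩

/-- The `ε`-free terms, where those that are equal under the truth assignment are identified. -/
def TermModel {w : Fm L → Prop} (hw : SatisfiesECEq w) : Type _ := Quotient hw.setoid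

variable {w : Fm L → Prop} (hw : SatisfiesECEq w)

/-- The element of the term model given by an `ε`-free term. -/
def mk (t : Tm L) (ht : t.EpsFree) : hw.TermModel := Quotient.mk hw.setoid ⟨t, ht⟩

theorem mk_eq_mk {t s : Tm L} (ht : t.EpsFree) (hs : s.EpsFree) :
    hw.mk t ht = hw.mk s hs ↔ w (.eq t s) :=
  Quotient.eq (r := hw.setoid)

/-- A representative of an element of the term model. -/
noncomputable def repr (x : hw.TermModel) : Tm L := (Quotient.out x).1

theorem epsFree_repr (x : hw.TermModel) : (hw.repr x).EpsFree := (Quotient.out x).2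

theorem mk_repr (x : hw.TermModel) : hw.mk (hw.repr x) (hw.epsFree_repr x) = x :=
  Quotient.out_eq x

theorem eq_repr_mk {t : Tm L} (ht : t.EpsFree) : w (.eq t (hw.repr (hw.mk t ht))) :=
  (hw.mk_eq_mk ht (hw.epsFree_repr _)).1 (hw.mk_repr _).symm

/-- The assignment under which each variable denotes its own class. -/
def varAssign (n : ℕ) : hw.TermModel := hw.mk (.var n) (Tm.epsFree_var n)

instance : Nonempty hw.TermModel := ⟨hw.varAssign 0⟩

/-- Function symbols act on terms, and relation symbols as the truth assignment says, evaluated at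
representatives. -/
noncomputable instance : L.Structure hw.TermModel where
  funMap f xs := hw.mk (.func f fun i => hw.repr (xs i)) fun i => hw.epsFree_repr (xs i)
  RelMap R xs := w (.rel R fun i => hw.repr (xs i))

theorem val_eq_mk {t : Tm L} (ht : t.EpsFree) :
    t.val hw.varAssign = hw.mk t ht := by
  induction t using Tm.rec (motive_2 := fun _ => True) with
  | var n => rfl
  | func f ts ih =>
    have hr : ∀ i, w (.eq (ts i) (hw.repr ((ts i).val hw.varAssign))) := fun i => by
      rw [ih i (ht i)]
      exact hw.eq_repr_mk (ht i)
    have hf : (Tm.func f fun i => hw.repr ((ts i).val hw.varAssign)).EpsFree :=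
      fun i => hw.epsFree_repr _
    exact (hw.mk_eq_mk hf ht).2 (hw.func_congr f hf ht
      fun i => hw.symm (ht i) (hw.epsFree_repr _) (hr i))
  | eps A => exact ht.elim
  | _ => trivial

theorem holds_iff_eval {A : Fm L} (hA : A.EpsFree) :
    A.Holds hw.varAssign ↔ A.eval w := by
  induction A using Fm.rec (motive_1 := fun _ => True) with
  | bot => rfl
  | top => rfl
  | rel R ts =>
    have hr : ∀ i, w (.eq (ts i) (hw.repr ((ts i).val hw.varAssign))) := by
      intro i
      rw [hw.val_eq_mk (hA i)]
      exact hw.eq_repr_mk (hA i)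
    exact ⟨hw.rel_congr R (fun i => hw.epsFree_repr _) hA
        fun i => hw.symm (hA i) (hw.epsFree_repr _) (hr i),
      hw.rel_congr R hA (fun i => hw.epsFree_repr _) hr⟩
  | eq t s =>
    rw [Fm.holds_eq, hw.val_eq_mk hA.1, hw.val_eq_mk hA.2, mk_eq_mk]
    rfl
  | neg A ih => exact not_congr (ih hA)
  | and A B ihA ihB => exact and_congr (ihA hA.1) (ihB hA.2)
  | or A B ihA ihB => exact or_congr (ihA hA.1) (ihB hA.2)
  | imp A B ihA ihB => exact imp_congr (ihA hA.1) (ihB hA.2)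
  | iff A B ihA ihB => exact iff_congr (ihA hA.1) (ihB hA.2)
  | _ => trivial

end SatisfiesECEq

end EpsilonCalculus

theorem mainTheorem1 (L : FirstOrder.Language.{u, v}) (E : EpsilonCalculus.Fm L)
    (hE : E.EpsFree) (h : EpsilonCalculus.ProvableECEpsEq E) :
    EpsilonCalculus.ProvableECEq E := by
  by_contra hn
  obtain ⟨w, hw, hwE⟩ := EpsilonCalculus.exists_valuation_of_not_provableECEq hE hn
  exact hwE ((hw.holds_iff_eval hE).1 (h.holds _))
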